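/- Let $\mathcal A$ be an abelian category and let $\mathcal T\subseteq\mathcal A$ be a full additive subcategory, closed under direct summands, consisting of projective objects of $\mathcal A$. Suppose that $\mathcal T$ is functorially finite: every object $X$ of $\mathcal A$ has a $\mathcal T$-precover $T_X\to X$ (that is, $T_X\in\mathcal T$ and every morphism from an object of $\mathcal T$ to $X$ factors through it) and, dually, a $\mathcal T$-preenvelope $X\to T^X$. Let $\langle\mathcal T\rangle$ be the ideal of morphisms that factor through an object of $\mathcal T$, and $\underline{\mathcal A}=\mathcal A/\langle\mathcal T\rangle$ the stable category. The category $\underline{\mathcal A}$ has its usual left and right triangulated structures. The loop functor $\Omega$ sends $X$ to the kernel of a $\mathcal T$-precover of $X$; the left triangles are the sequences isomorphic to some $\Omega C\to\ker g\to B\xrightarrow{\,g\,}C$, where every morphism from an object of $\mathcal T$ to $C$ lifts along $g\in\mathcal A(B,C)$ and the first morphism is induced by a lift of the precover $T_C\to C$ along $g$. The suspension functor $\Sigma$ and the right triangles $X\to Y\to Z\to\Sigma X$ are defined dually. A morphism $f:X\to Y$ of $\underline{\mathcal A}$ is a strong monomorphism if there is a left triangle $\Omega Y\to 0\to X\xrightarrow{\,f\,}Y$,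 and a strong epimorphism if there is a right triangle $X\xrightarrow{\,f\,}Y\to 0\to\Sigma X$. The category $\underline{\mathcal A}$ is weakly balanced if every morphism that is both a strong monomorphism and a strong epimorphism is an isomorphism. Consider the following assertions: 1. For every $T\in\mathcal T$ there is a monomorphism $T\rightarrowtail E$, where $E$ is an injective object of $\mathcal A$ that belongs to $\mathcal T$. 2. For every nonzero $T\in\mathcal T$ there is a nonzero morphism $\varphi:T\to T'$, with $T'\in\mathcal T$, that factors through an injective object of $\mathcal A$. 3. The category $\underline{\mathcal A}$ is weakly balanced. 4. If $f:X\to Y$ is an epimorphism in $\mathcal A$ such that $\ker(f)\in\mathcal T$ and every morphism $h:X\to T$ with $T\in\mathcal T$ vanishes on $\ker(f)$, then $f$ is an isomorphism in $\mathcal A$. 5. If $j:T\to X$ is a monomorphism in $\mathcal A$ with $0\neq T\in\mathcal T$, then there is a morphism $h:X\to T'$, for some $T'\in\mathcal T$, such that $hj\neq 0$. 6. If $Y$ is an object of $\mathcal A$ such that the covariant functor $\operatorname{Ext}^1_{\mathcal A}(Y,?)_{|\mathcal T}$ from $\mathcal T$ to abelian groups is nonzero, then this functor contains no nonzero representable subfunctor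 (that is, no nonzero subfunctor isomorphic to $\mathcal T(T,?)$ for some $T\in\mathcal T$). Then $1)\Rightarrow 2)\Rightarrow 3)\Leftrightarrow 4)\Leftrightarrow 5)\Leftrightarrow 6)$. If moreover $\mathcal A$ has enough injectives, then assertions $2)$–$6)$ are all equivalent. -/

import Mathlib

open CategoryTheory Limits

universe w v u

noncomputable section

namespace StableCat

variable {A : Type u} [Category.{v} A] [Abelian A] (T : ObjectProperty A)

/-! ### The ideal `<T>` and the stable category `A/<T>` -/

/-- `f` belongs to the ideal `<T>`: it factors through an object of `T`. -/
def FactorsThrough {X Y : A} (f : X ⟶ Y) : Prop :=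
  ∃ (P : A) (_ : T P) (a : X ⟶ P) (b : P ⟶ Y), a ≫ b = f

/-- Two parallel morphisms are identified when their difference lies in `<T>`. -/
def idealRel : HomRel A := fun _ _ f g => FactorsThrough T (f - g)

/-- For an additive full subcategory, the relation is a congruence, so that the hom-sets of the
quotient category are the quotients of those of `A` by the ideal `<T>`. -/
instance idealRel_congruence [T.IsClosedUnderFiniteProducts] : Congruence (idealRel T) where
  equivalence := by
    intro X Y
    refine ⟨fun f => ?_, ?_, ?_⟩
    · exact ⟨⊤_ A, T.prop_terminal, 0, 0, by simp⟩
    · rintro f g ⟨P, hP, a, b, h⟩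
      exact ⟨P, hP, -a, b, by rw [Preadditive.neg_comp, h, neg_sub]⟩
    · rintro f g k ⟨P, hP, a, b, h⟩ ⟨P', hP', a', b', h'⟩
      refine ⟨P ⨯ P', T.prop_prod _ _ hP hP', prod.lift a a', prod.fst ≫ b + prod.snd ≫ b', ?_⟩
      rw [Preadditive.comp_add, prod.lift_fst_assoc, prod.lift_snd_assoc, h, h']
      abel
  comp_left := by
    rintro X Y Z f g g' ⟨P, hP, a, b, h⟩
    exact ⟨P, hP, f ≫ a, b, by rw [Category.assoc, h, Preadditive.comp_sub]⟩
  comp_right := by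
    rintro X Y Z f f' g ⟨P, hP, a, b, h⟩
    exact ⟨P, hP, a, b ≫ g, by rw [← Category.assoc, h, Preadditive.sub_comp]⟩

/-- The stable category `A/<T>`. -/
abbrev Stable : Type u := CategoryTheory.Quotient (idealRel T)

/-- The canonical projection `A ⥤ A/<T>`. -/
abbrev proj : A ⥤ Stable T := CategoryTheory.Quotient.functor (idealRel T)

/-! ### Precovers, preenvelopes, functorial finiteness -/

/-- `p : P ⟶ X` is a `T`-precover of `X`. -/
structure IsPrecover {P X : A} (p : P ⟶ X) : Prop where
  mem : T P
  exists_lift : ∀ {Q : A}, T Q → ∀ g : Q ⟶ X, ∃ h : Q ⟶ P, h ≫ p = g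

/-- `m : X ⟶ P` is a `T`-preenvelope of `X`. -/
structure IsPreenvelope {X P : A} (m : X ⟶ P) : Prop where
  mem : T P
  exists_desc : ∀ {Q : A}, T Q → ∀ g : X ⟶ Q, ∃ h : P ⟶ Q, m ≫ h = g

/-- `T` is contravariantly finite: every object has a `T`-precover. -/
class ContravariantlyFinite : Prop where
  exists_precover : ∀ X : A, ∃ (P : A) (p : P ⟶ X), IsPrecover T p

/-- `T` is covariantly finite: every object has a `T`-preenvelope. -/
class CovariantlyFinite : Prop where
  exists_preenvelope : ∀ X : A, ∃ (P : A) (m : X ⟶ P), IsPreenvelope T m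

/-- `T` is functorially finite: both contravariantly and covariantly finite. -/
class FunctoriallyFinite : Prop extends ContravariantlyFinite T, CovariantlyFinite T

/-- Every morphism from an object of `T` to the target of `g` lifts along `g`. -/
def IsTEpic {B C : A} (g : B ⟶ C) : Prop :=
  ∀ ⦃Q : A⦄, T Q → ∀ q : Q ⟶ C, ∃ h : Q ⟶ B, h ≫ g = q

/-- Every morphism from the source of `f` to an object of `T` extends along `f`. -/
def IsTMonic {B C : A} (f : B ⟶ C) : Prop :=
  ∀ ⦃Q : A⦄, T Q → ∀ q : B ⟶ Q, ∃ h : C ⟶ Q, f ≫ h = q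

/-! ### The left triangulated structure -/

section Left

variable [ContravariantlyFinite T]

/-- The source of a chosen `T`-precover of `X`. -/
def coverObj (X : A) : A := (ContravariantlyFinite.exists_precover (T := T) X).choose

/-- A chosen `T`-precover of `X`. -/
def cover (X : A) : coverObj T X ⟶ X :=
  (ContravariantlyFinite.exists_precover (T := T) X).choose_spec.choose

lemma cover_isPrecover (X : A) : IsPrecover T (cover T X) :=
  (ContravariantlyFinite.exists_precover (T := T) X).choose_spec.choose_spec

/-- The loop object: the kernel of the chosen `T`-precover. -/
abbrev loopObj (X : A) : A := kernel (cover T X)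

/-- The inclusion of the loop object. -/
abbrev loopι (X : A) : loopObj T X ⟶ coverObj T X := kernel.ι (cover T X)

lemma loopι_cover (X : A) : loopι T X ≫ cover T X = 0 := kernel.condition _

lemma exists_coverMap {X Y : A} (f : X ⟶ Y) :
    ∃ l : coverObj T X ⟶ coverObj T Y, l ≫ cover T Y = cover T X ≫ f :=
  (cover_isPrecover T Y).exists_lift (cover_isPrecover T X).mem _

/-- A chosen lift of `f` to the precovers. -/
def coverMap {X Y : A} (f : X ⟶ Y) : coverObj T X ⟶ coverObj T Y := (exists_coverMap T f).choose

lemma coverMap_cover {X Y : A} (f : X ⟶ Y) :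
    coverMap T f ≫ cover T Y = cover T X ≫ f := (exists_coverMap T f).choose_spec

/-- The morphism induced by `f` on loop objects. -/
def loopMap {X Y : A} (f : X ⟶ Y) : loopObj T X ⟶ loopObj T Y :=
  kernel.lift (cover T Y) (loopι T X ≫ coverMap T f)
    (by rw [Category.assoc, coverMap_cover, ← Category.assoc, loopι_cover, zero_comp])

lemma loopMap_ι {X Y : A} (f : X ⟶ Y) : loopMap T f ≫ loopι T Y = loopι T X ≫ coverMap T f :=
  kernel.lift_ι _ _ _

/-- Morphisms induced on loop objects by stably equal morphisms are stably equal. -/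
lemma loop_rel {X Y : A} {f f' : X ⟶ Y} (hf : idealRel T f f')
    {l l' : coverObj T X ⟶ coverObj T Y} (hl : l ≫ cover T Y = cover T X ≫ f)
    (hl' : l' ≫ cover T Y = cover T X ≫ f') {k k' : loopObj T X ⟶ loopObj T Y}
    (hk : k ≫ loopι T Y = loopι T X ≫ l) (hk' : k' ≫ loopι T Y = loopι T X ≫ l') :
    idealRel T k k' := by
  obtain ⟨P, hP, a, b, h⟩ := hf
  obtain ⟨b', hb'⟩ := (cover_isPrecover T Y).exists_lift hP b
  have hs : (l - l' - cover T X ≫ a ≫ b') ≫ cover T Y = 0 := by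
    rw [Preadditive.sub_comp, Preadditive.sub_comp, hl, hl', Category.assoc, Category.assoc, hb',
      h, Preadditive.comp_sub, sub_self]
  refine ⟨coverObj T X, (cover_isPrecover T X).mem, loopι T X, kernel.lift _ _ hs, ?_⟩
  rw [← cancel_mono (loopι T Y), Category.assoc]
  have e : kernel.lift (cover T Y) _ hs ≫ loopι T Y = l - l' - cover T X ≫ a ≫ b' :=
    kernel.lift_ι _ _ _
  rw [e, Preadditive.sub_comp, hk, hk', Preadditive.comp_sub, Preadditive.comp_sub,
    ← Category.assoc (loopι T X) (cover T X), loopι_cover, zero_comp, sub_zero]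

lemma idealRel_refl_left {X Y : A} (f : X ⟶ Y) : idealRel T f f :=
  ⟨coverObj T X, (cover_isPrecover T X).mem, 0, 0, by simp⟩

/-- The loop construction as a functor `A ⥤ A/<T>`. -/
abbrev loopPre : A ⥤ Stable T where
  obj X := (proj T).obj (loopObj T X)
  map f := (proj T).map (loopMap T f)
  map_id X := by
    rw [← (proj T).map_id]
    exact CategoryTheory.Quotient.sound _ (loop_rel T (idealRel_refl_left T (𝟙 X)) (coverMap_cover T _)
      (l' := 𝟙 _) (by simp) (loopMap_ι T _) (by simp))
  map_comp f g := by
    rw [← (proj T).map_comp]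
    refine CategoryTheory.Quotient.sound _ (loop_rel T (idealRel_refl_left T (f ≫ g)) (coverMap_cover T _)
      (l' := coverMap T f ≫ coverMap T g) ?_ (loopMap_ι T _) ?_)
    · rw [Category.assoc, coverMap_cover, ← Category.assoc, coverMap_cover, Category.assoc]
    · rw [Category.assoc, loopMap_ι, ← Category.assoc, loopMap_ι, Category.assoc]

/-- The loop functor `Ω` of the stable category. -/
abbrev loop : Stable T ⥤ Stable T :=
  CategoryTheory.Quotient.lift _ (loopPre T) fun _ _ _ _ h =>
    CategoryTheory.Quotient.sound _
      (loop_rel T h (coverMap_cover T _) (coverMap_cover T _) (loopMap_ι T _) (loopMap_ι T _))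

/-- Sequences `ΩY ⟶ Z ⟶ X ⟶ Y` in the stable category. -/
structure LeftCandidate where
  Z : Stable T
  X : Stable T
  Y : Stable T
  h : (loop T).obj Y ⟶ Z
  g : Z ⟶ X
  f : X ⟶ Y

/-- Two sequences `ΩY ⟶ Z ⟶ X ⟶ Y` are isomorphic, through `(Ωc, a, b, c)`. -/
def LeftCandidate.IsIso (s t : LeftCandidate T) : Prop :=
  ∃ (a : s.Z ≅ t.Z) (b : s.X ≅ t.X) (c : s.Y ≅ t.Y),
    s.h ≫ a.hom = (loop T).map c.hom ≫ t.h ∧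
    s.g ≫ b.hom = a.hom ≫ t.g ∧
    s.f ≫ c.hom = b.hom ≫ t.f

/-- The standard left triangle `ΩC ⟶ ker g ⟶ B ⟶ C` of `g : B ⟶ C`, where `l` lifts the
precover of `C` along `g` and the first morphism is the restriction of `l` to the kernels. -/
def standardLeft {B C : A} (g : B ⟶ C) (l : coverObj T C ⟶ B) (hl : l ≫ g = cover T C) :
    LeftCandidate T where
  Z := (proj T).obj (kernel g)
  X := (proj T).obj B
  Y := (proj T).obj C
  h := (proj T).map (kernel.lift g (loopι T C ≫ l)
    (by rw [Category.assoc, hl, loopι_cover]) : loopObj T C ⟶ kernel g)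
  g := (proj T).map (kernel.ι g)
  f := (proj T).map g

/-- The left triangles of the stable category: the sequences isomorphic to a standard left
triangle of a `T`-epic morphism of `A`. -/
def IsLeftTriangle (t : LeftCandidate T) : Prop :=
  ∃ (B C : A) (g : B ⟶ C) (_ : IsTEpic T g) (l : coverObj T C ⟶ B) (hl : l ≫ g = cover T C),
    LeftCandidate.IsIso T t (standardLeft T g l hl)

/-- `f` is a strong monomorphism: there is a left triangle `ΩY ⟶ 0 ⟶ X ⟶ Y` ending in `f`. -/
def IsStrongMono {X Y : Stable T} (f : X ⟶ Y) : Prop :=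
  ∃ (Z : Stable T) (_ : IsZero Z) (h : (loop T).obj Y ⟶ Z) (g : Z ⟶ X),
    IsLeftTriangle T ⟨Z, X, Y, h, g, f⟩

end Left

/-! ### The right triangulated structure -/

section Right

variable [CovariantlyFinite T]

/-- The target of a chosen `T`-preenvelope of `X`. -/
def envObj (X : A) : A := (CovariantlyFinite.exists_preenvelope (T := T) X).choose

/-- A chosen `T`-preenvelope of `X`. -/
def env (X : A) : X ⟶ envObj T X :=
  (CovariantlyFinite.exists_preenvelope (T := T) X).choose_spec.choose

lemma env_isPreenvelope (X : A) : IsPreenvelope T (env T X) :=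
  (CovariantlyFinite.exists_preenvelope (T := T) X).choose_spec.choose_spec

/-- The suspension object: the cokernel of the chosen `T`-preenvelope. -/
abbrev suspObj (X : A) : A := cokernel (env T X)

/-- The projection onto the suspension object. -/
abbrev suspπ (X : A) : envObj T X ⟶ suspObj T X := cokernel.π (env T X)

lemma env_suspπ (X : A) : env T X ≫ suspπ T X = 0 := cokernel.condition _

lemma exists_envMap {X Y : A} (f : X ⟶ Y) :
    ∃ l : envObj T X ⟶ envObj T Y, env T X ≫ l = f ≫ env T Y :=
  (env_isPreenvelope T X).exists_desc (env_isPreenvelope T Y).mem _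

/-- A chosen extension of `f` to the preenvelopes. -/
def envMap {X Y : A} (f : X ⟶ Y) : envObj T X ⟶ envObj T Y := (exists_envMap T f).choose

lemma env_envMap {X Y : A} (f : X ⟶ Y) :
    env T X ≫ envMap T f = f ≫ env T Y := (exists_envMap T f).choose_spec

/-- The morphism induced by `f` on suspension objects. -/
def suspMap {X Y : A} (f : X ⟶ Y) : suspObj T X ⟶ suspObj T Y :=
  cokernel.desc (env T X) (envMap T f ≫ suspπ T Y)
    (by rw [← Category.assoc, env_envMap, Category.assoc, env_suspπ, comp_zero])

lemma π_suspMap {X Y : A} (f : X ⟶ Y) : suspπ T X ≫ suspMap T f = envMap T f ≫ suspπ T Y :=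
  cokernel.π_desc _ _ _

/-- Morphisms induced on suspension objects by stably equal morphisms are stably equal. -/
lemma susp_rel {X Y : A} {f f' : X ⟶ Y} (hf : idealRel T f f')
    {l l' : envObj T X ⟶ envObj T Y} (hl : env T X ≫ l = f ≫ env T Y)
    (hl' : env T X ≫ l' = f' ≫ env T Y) {k k' : suspObj T X ⟶ suspObj T Y}
    (hk : suspπ T X ≫ k = l ≫ suspπ T Y) (hk' : suspπ T X ≫ k' = l' ≫ suspπ T Y) :
    idealRel T k k' := by
  obtain ⟨P, hP, a, b, h⟩ := hf
  obtain ⟨a', ha'⟩ := (env_isPreenvelope T X).exists_desc hP a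
  have hs : env T X ≫ (l - l' - a' ≫ b ≫ env T Y) = 0 := by
    rw [Preadditive.comp_sub, Preadditive.comp_sub, hl, hl', ← Category.assoc, ha',
      ← Category.assoc, h, Preadditive.sub_comp, sub_self]
  refine ⟨envObj T Y, (env_isPreenvelope T Y).mem, cokernel.desc _ _ hs, suspπ T Y, ?_⟩
  rw [← cancel_epi (suspπ T X)]
  have e : suspπ T X ≫ cokernel.desc (env T X) _ hs = l - l' - a' ≫ b ≫ env T Y :=
    cokernel.π_desc _ _ _
  rw [← Category.assoc, e, Preadditive.comp_sub, hk, hk', Preadditive.sub_comp, Preadditive.sub_comp,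
    Category.assoc, Category.assoc, env_suspπ, comp_zero, comp_zero, sub_zero]

lemma idealRel_refl_right {X Y : A} (f : X ⟶ Y) : idealRel T f f :=
  ⟨envObj T X, (env_isPreenvelope T X).mem, 0, 0, by simp⟩

/-- The suspension construction as a functor `A ⥤ A/<T>`. -/
abbrev suspPre : A ⥤ Stable T where
  obj X := (proj T).obj (suspObj T X)
  map f := (proj T).map (suspMap T f)
  map_id X := by
    rw [← (proj T).map_id]
    exact CategoryTheory.Quotient.sound _ (susp_rel T (idealRel_refl_right T (𝟙 X)) (env_envMap T _)
      (l' := 𝟙 _) (by simp) (π_suspMap T _) (by simp))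
  map_comp f g := by
    rw [← (proj T).map_comp]
    refine CategoryTheory.Quotient.sound _ (susp_rel T (idealRel_refl_right T (f ≫ g)) (env_envMap T _)
      (l' := envMap T f ≫ envMap T g) ?_ (π_suspMap T _) ?_)
    · rw [← Category.assoc, env_envMap, Category.assoc, env_envMap, Category.assoc]
    · rw [← Category.assoc, π_suspMap, Category.assoc, π_suspMap, Category.assoc]

/-- The suspension functor `Σ` of the stable category. -/
abbrev susp : Stable T ⥤ Stable T :=
  CategoryTheory.Quotient.lift _ (suspPre T) fun _ _ _ _ h =>
    CategoryTheory.Quotient.sound _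
      (susp_rel T h (env_envMap T _) (env_envMap T _) (π_suspMap T _) (π_suspMap T _))

/-- Sequences `X ⟶ Y ⟶ Z ⟶ ΣX` in the stable category. -/
structure RightCandidate where
  X : Stable T
  Y : Stable T
  Z : Stable T
  f : X ⟶ Y
  g : Y ⟶ Z
  h : Z ⟶ (susp T).obj X

/-- Two sequences `X ⟶ Y ⟶ Z ⟶ ΣX` are isomorphic, through `(a, b, c, Σa)`. -/
def RightCandidate.IsIso (s t : RightCandidate T) : Prop :=
  ∃ (a : s.X ≅ t.X) (b : s.Y ≅ t.Y) (c : s.Z ≅ t.Z),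
    s.f ≫ b.hom = a.hom ≫ t.f ∧
    s.g ≫ c.hom = b.hom ≫ t.g ∧
    s.h ≫ (susp T).map a.hom = c.hom ≫ t.h

/-- The standard right triangle `B ⟶ C ⟶ coker f ⟶ ΣB` of `f : B ⟶ C`, where `l` extends the
preenvelope of `B` along `f` and the last morphism is induced by `l` on the cokernels. -/
def standardRight {B C : A} (f : B ⟶ C) (l : C ⟶ envObj T B) (hl : f ≫ l = env T B) :
    RightCandidate T where
  X := (proj T).obj B
  Y := (proj T).obj C
  Z := (proj T).obj (cokernel f)
  f := (proj T).map f
  g := (proj T).map (cokernel.π f)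
  h := (proj T).map (cokernel.desc f (l ≫ suspπ T B)
    (by rw [← Category.assoc, hl, env_suspπ]) : cokernel f ⟶ suspObj T B)

/-- The right triangles of the stable category: the sequences isomorphic to a standard right
triangle of a `T`-monic morphism of `A`. -/
def IsRightTriangle (t : RightCandidate T) : Prop :=
  ∃ (B C : A) (f : B ⟶ C) (_ : IsTMonic T f) (l : C ⟶ envObj T B) (hl : f ≫ l = env T B),
    RightCandidate.IsIso T t (standardRight T f l hl)

/-- `f` is a strong epimorphism: there is a right triangle `X ⟶ Y ⟶ 0 ⟶ ΣX` starting with `f`. -/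
def IsStrongEpi {X Y : Stable T} (f : X ⟶ Y) : Prop :=
  ∃ (Z : Stable T) (_ : IsZero Z) (g : Y ⟶ Z) (h : Z ⟶ (susp T).obj X),
    IsRightTriangle T ⟨X, Y, Z, f, g, h⟩

end Right

/-- The stable category is weakly balanced: every morphism that is both a strong monomorphism and
a strong epimorphism is an isomorphism. -/
def WeaklyBalanced [FunctoriallyFinite T] : Prop :=
  ∀ ⦃X Y : Stable T⦄ (f : X ⟶ Y), IsStrongMono T f → IsStrongEpi T f → IsIso f

/-! ### The covariant functor `Ext¹(Y, ?)` restricted to `T` -/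

/-- The functor `Ext¹(Y, ?)` restricted to the full subcategory `T`. -/
def extRestrict [HasExt.{w} A] (Y : A) : T.FullSubcategory ⥤ AddCommGrpCat.{w} :=
  T.ι ⋙ Abelian.extFunctorObj.{w} Y 1

/-- A functor from `T` to abelian groups is representable: it is isomorphic to `T(P, ?)` for an
object `P` of `T` (both functors are lifted to a common universe). -/
def IsRepresentable (F : T.FullSubcategory ⥤ AddCommGrpCat.{w}) : Prop :=
  ∃ P : T.FullSubcategory,
    Nonempty (F ⋙ AddCommGrpCat.uliftFunctor.{v, w} ≅
      preadditiveCoyoneda.obj (Opposite.op P) ⋙ AddCommGrpCat.uliftFunctor.{w, v})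

/-- `G` contains a nonzero representable subfunctor. -/
def HasNonzeroRepresentableSubfunctor (G : T.FullSubcategory ⥤ AddCommGrpCat.{w}) : Prop :=
  ∃ (F : T.FullSubcategory ⥤ AddCommGrpCat.{w}) (i : F ⟶ G),
    Mono i ∧ IsRepresentable T F ∧ ¬ IsZero F

/-! ### The six assertions -/

/-- Every object of `T` embeds in an injective object of `A` that belongs to `T`. -/
def EmbedsInInjectives : Prop :=
  ∀ P : A, T P → ∃ (E : A) (j : P ⟶ E), T E ∧ Injective E ∧ Mono j

/-- Every nonzero object of `T` has a nonzero morphism to an object of `T` that factors through an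
injective object of `A`. -/
def HasNonzeroMapThroughInjective : Prop :=
  ∀ P : A, T P → ¬ IsZero P → ∃ (P' : A) (φ : P ⟶ P'), T P' ∧ φ ≠ 0 ∧
    ∃ (E : A) (a : P ⟶ E) (b : E ⟶ P'), Injective E ∧ a ≫ b = φ

/-- An epimorphism with kernel in `T` on which all morphisms to objects of `T` vanish is an
isomorphism. -/
def EpiVanishingIsIso : Prop :=
  ∀ ⦃X Y : A⦄ (f : X ⟶ Y), Epi f → T (kernel f) →
    (∀ ⦃P : A⦄, T P → ∀ h : X ⟶ P, kernel.ι f ≫ h = 0) → IsIso f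

/-- Every monomorphism from a nonzero object of `T` is detected by a morphism to an object
of `T`. -/
def MonoDetected : Prop :=
  ∀ ⦃P X : A⦄ (j : P ⟶ X), T P → ¬ IsZero P → Mono j →
    ∃ (P' : A) (h : X ⟶ P'), T P' ∧ j ≫ h ≠ 0

/-- Whenever the functor `Ext¹(Y, ?)` restricted to `T` is nonzero, it does not contain a nonzero
representable subfunctor. -/
def ExtHasNoRepresentable [HasExt.{w} A] : Prop :=
  ∀ Y : A, ¬ IsZero (extRestrict.{w} T Y) →
    ¬ HasNonzeroRepresentableSubfunctor T (extRestrict.{w} T Y)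

end StableCat

end

/-! Everything turns on `MonoDetected`. Injectivity extends a map along a monomorphism out of `P`,
which gives it from maps through injectives; conversely, with enough injectives, it is applied to an
embedding of `P` in an injective. A monomorphism and its cokernel translate it into
`EpiVanishingIsIso`.

Weak balance: an epimorphism with kernel in `T` on which maps to `T` vanish is strong mono and
strong epi in the stable category, and a stable inverse forces its kernel to vanish. Conversely,
projectivity replaces a strong epimorphism by an actual `T`-monic epimorphism `e`
(`IsStrongEpi.exists_epi`). If the morphism is also a strong monomorphism,
`prop_kernel_of_arrow_iso` puts `kernel e` in `T`, so `e` is an isomorphism.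

Ext: a pushout of the class of `P ⟶ X ⟶ Y` along `f : P ⟶ Q` is zero exactly when `f` extends to
`X`. Hence the class embeds `T(P, ?)` in `Ext¹(Y, ?)` iff all maps from `X` to `T` vanish on `P`. -/

section

/-! ### Extension classes killed by a monomorphism. -/

open Abelian Pretriangulated DerivedCategory

/-- Every class in `Ext¹(Y, P)` is annihilated by a monomorphism out of `P` (the middle term of
an extension that represents the class). -/
lemma CategoryTheory.Abelian.Ext.exists_mono_comp_eq_zero {A : Type u} [Category.{v} A] [Abelian A] [HasExt.{w} A]
    {Y P : A} (x : Ext.{w} Y P 1) :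
    ∃ (X : A) (j : P ⟶ X), Mono j ∧ x.comp (Ext.mk₀ j) (add_zero 1) = 0 := by
  let := HasDerivedCategory.standard A
  -- Seen as a morphism `Y ⟶ P⟦1⟧`, the class sits in a triangle `P ⟶ Z ⟶ Y ⟶ P⟦1⟧`; `Z` lies
  -- between two objects of the heart, so it is in the heart as well.
  obtain ⟨Z, f, g, hT⟩ := distinguished_cocone_triangle₂
    (C := DerivedCategory A) (Z := (singleFunctor A 0).obj Y) (X := (singleFunctor A 0).obj P) x.hom
  have : Z.IsLE 0 := TStructure.t.isLE₂ _ hT 0 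
    (inferInstanceAs (((singleFunctor A 0).obj P).IsLE 0))
    (inferInstanceAs (((singleFunctor A 0).obj Y).IsLE 0))
  have : Z.IsGE 0 := TStructure.t.isGE₂ _ hT 0 
    (inferInstanceAs (((singleFunctor A 0).obj P).IsGE 0))
    (inferInstanceAs (((singleFunctor A 0).obj Y).IsGE 0))
  obtain ⟨X, ⟨e⟩⟩ := exists_iso_singleFunctor_obj_of_isGE_of_isLE Z 0
  obtain ⟨j, hj⟩ := (singleFunctor A 0).map_surjective (f ≫ e.hom)
  refine ⟨X, j, ?_, ?_⟩
  · refine Preadditive.mono_of_cancel_zero _ fun {W} k hk => ?_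
    apply (singleFunctor A 0).map_injective
    have h0 : (singleFunctor A 0).map k ≫ f = 0 := by
      rw [← cancel_mono e.hom, Category.assoc, ← hj, ← Functor.map_comp, hk, Functor.map_zero,
        Limits.zero_comp]
    -- A map killed by `f` factors through `Y⟦-1⟧`, which lives in degree 1, while its source lives
    -- in degree 0: the factor is zero.
    obtain ⟨l, hl⟩ := Triangle.coyoneda_exact₂ _ (inv_rot_of_distTriang _ hT)
      ((singleFunctor A 0).map k) h0
    have : TStructure.t.IsGE (Triangle.mk f g x.hom).invRotate.obj₁ 1 :=
      TStructure.t.isGE_shift ((singleFunctor A 0).obj Y) 0 (-1) 1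
    rw [hl, TStructure.t.zero l 0 1, Functor.map_zero]
    exact Limits.zero_comp
  · ext
    rw [Ext.comp_hom, Ext.mk₀_hom, Ext.zero_hom, ShiftedHom.comp_mk₀, hj, Functor.map_comp]
    have h31 : x.hom ≫ f⟦(1 : ℤ)⟧' = 0 := comp_distTriang_mor_zero₃₁ _ hT
    exact (Category.assoc _ _ _).symm.trans ((h31 =≫ e.hom⟦(1 : ℤ)⟧').trans Limits.zero_comp)

end

/-! ### The ideal of morphisms through `T` and the stable category. -/

namespace StableCat

variable {A : Type u} [Category.{v} A] [Abelian A] {T : ObjectProperty A}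

namespace FactorsThrough

variable {X Y Z : A}

lemma add [T.IsClosedUnderFiniteProducts] {f g : X ⟶ Y} (hf : FactorsThrough T f)
    (hg : FactorsThrough T g) : FactorsThrough T (f + g) := by
  obtain ⟨P, hP, a, b, rfl⟩ := hf
  obtain ⟨P', hP', a', b', rfl⟩ := hg
  exact ⟨P ⨯ P', T.prop_prod _ _ hP hP', prod.lift a a', prod.fst ≫ b + prod.snd ≫ b',
    by rw [Preadditive.comp_add, prod.lift_fst_assoc, prod.lift_snd_assoc]⟩

omit [Abelian A] in
lemma comp_left (f : X ⟶ Y) {g : Y ⟶ Z} (hg : FactorsThrough T g) : FactorsThrough T (f ≫ g) := by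
  obtain ⟨P, hP, a, b, rfl⟩ := hg
  exact ⟨P, hP, f ≫ a, b, Category.assoc _ _ _⟩

omit [Abelian A] in
lemma comp_right {f : X ⟶ Y} (hf : FactorsThrough T f) (g : Y ⟶ Z) : FactorsThrough T (f ≫ g) := by
  obtain ⟨P, hP, a, b, rfl⟩ := hf
  exact ⟨P, hP, a, b ≫ g, (Category.assoc _ _ _).symm⟩

omit [Abelian A] in
lemma of_prop_left (hX : T X) (f : X ⟶ Y) : FactorsThrough T f := ⟨X, hX, 𝟙 X, f, by simp⟩

end FactorsThrough

-- Closure under direct summands becomes a membership criterion: a factorization of the identity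
-- exhibits a retract.
omit [Abelian A] in
lemma prop_of_factorsThrough_id [T.IsStableUnderRetracts] {X : A}
    (h : FactorsThrough T (𝟙 X)) : T X := by
  obtain ⟨P, hP, a, b, h⟩ := h
  exact T.prop_of_retract ⟨a, b, h⟩ hP

section Stable

variable [T.IsClosedUnderFiniteProducts]

lemma proj_map_eq_iff {X Y : A} (f g : X ⟶ Y) :
    (proj T).map f = (proj T).map g ↔ FactorsThrough T (f - g) :=
  CategoryTheory.Quotient.functor_map_eq_iff (idealRel T) f g

lemma isZero_proj_obj {X : A} (hX : T X) : IsZero ((proj T).obj X) := by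
  have h (Y : Stable T) (f : (proj T).obj X ⟶ Y) (g : (proj T).obj X ⟶ Y) : f = g := by
    obtain ⟨f, rfl⟩ : ∃ f' : X ⟶ Y.as, (proj T).map f' = f := (proj T).map_surjective (Y := Y.as) f
    obtain ⟨g, rfl⟩ : ∃ g' : X ⟶ Y.as, (proj T).map g' = g := (proj T).map_surjective (Y := Y.as) g
    exact (proj_map_eq_iff f g).2 (.of_prop_left hX _)
  have h' (Y : Stable T) (f : Y ⟶ (proj T).obj X) (g : Y ⟶ (proj T).obj X) : f = g := by
    obtain ⟨f, rfl⟩ : ∃ f' : Y.as ⟶ X, (proj T).map f' = f := (proj T).map_surjective (X := Y.as) f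
    obtain ⟨g, rfl⟩ : ∃ g' : Y.as ⟶ X, (proj T).map g' = g := (proj T).map_surjective (X := Y.as) g
    exact (proj_map_eq_iff f g).2 ⟨X, hX, f - g, 𝟙 X, by simp⟩
  exact ⟨fun Y => ⟨⟨⟨(proj T).map (0 : X ⟶ Y.as)⟩, fun _ => h _ _ _⟩⟩,
    fun Y => ⟨⟨⟨(proj T).map (0 : Y.as ⟶ X)⟩, fun _ => h' _ _ _⟩⟩⟩

lemma prop_of_isZero_proj_obj [T.IsStableUnderRetracts] {X : A}
    (h : IsZero ((proj T).obj X)) : T X := by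
  refine prop_of_factorsThrough_id ?_
  have := (proj_map_eq_iff (T := T) (𝟙 X) 0).1 (h.eq_of_src _ _)
  simpa using this

/-- The kernels of stably isomorphic `T`-epic morphisms: if one of them belongs to `T`, so does
the other. -/
lemma prop_kernel_of_arrow_iso [T.IsStableUnderRetracts] {B C B' C' : A} {g : B ⟶ C} {e : B' ⟶ C'}
    (hg : IsTEpic T g) (he : IsTEpic T e) (hK : T (kernel g))
    (i : (proj T).obj B' ≅ (proj T).obj B) (k : (proj T).obj C' ≅ (proj T).obj C)
    (w : (proj T).map e ≫ k.hom = i.hom ≫ (proj T).map g) : T (kernel e) := by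
  -- A square commuting modulo the ideal can be made strict: the error factors through an object of
  -- `T`, its second factor lifts along the `T`-epic `g`, and subtracting the result does not change
  -- the stable class.
  have lift {B C B' C' : A} {g : B ⟶ C} {e : B' ⟶ C'} (hg : IsTEpic T g)
      (i : (proj T).obj B' ⟶ (proj T).obj B) (c : C' ⟶ C)
      (w : (proj T).map e ≫ (proj T).map c = i ≫ (proj T).map g) :
      ∃ b : B' ⟶ B, (proj T).map b = i ∧ b ≫ g = e ≫ c := by
    obtain ⟨b, rfl⟩ := (proj T).map_surjective i
    rw [← Functor.map_comp, ← Functor.map_comp, eq_comm, proj_map_eq_iff] at w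
    obtain ⟨P, hP, s, t, hst⟩ := w
    obtain ⟨t', rfl⟩ := hg hP t
    refine ⟨b - s ≫ t', ?_, ?_⟩
    · exact (proj_map_eq_iff _ _).2 ⟨P, hP, -s, t', by simp⟩
    · rw [Preadditive.sub_comp, Category.assoc, hst, sub_sub_cancel]
  obtain ⟨c, hc⟩ := (proj T).map_surjective k.hom
  obtain ⟨c', hc'⟩ := (proj T).map_surjective k.inv
  obtain ⟨b, hb, hbe⟩ := lift (e := e) hg i.hom c (by rw [hc, w])
  obtain ⟨b', hb', hbe'⟩ := lift (e := g) he i.inv c'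
    (by rw [hc', Iso.eq_inv_comp, ← reassoc_of% w, Iso.hom_inv_id, Category.comp_id])
  have hφ : FactorsThrough T (𝟙 B' - b ≫ b') := by
    rw [← proj_map_eq_iff, Functor.map_comp, hb, hb', Iso.hom_inv_id, CategoryTheory.Functor.map_id]
  have hψ : FactorsThrough T (𝟙 C' - c ≫ c') := by
    rw [← proj_map_eq_iff, Functor.map_comp, hc, hc', Iso.hom_inv_id, CategoryTheory.Functor.map_id]
  obtain ⟨P, hP, p, q, hpq⟩ := hψ
  obtain ⟨q', rfl⟩ := he hP q
  -- `b ≫ b'` and `c ≫ c'` are identities only modulo the ideal. Subtracting a lift of the error on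
  -- `C'` makes the error on `B'` land in `kernel e`.
  let s : B' ⟶ kernel e := kernel.lift e (𝟙 B' - b ≫ b' - e ≫ p ≫ q') (by
    rw [Preadditive.sub_comp, Preadditive.sub_comp, Category.assoc, Category.assoc, hbe',
      reassoc_of% hbe, Category.assoc, hpq, Preadditive.comp_sub]
    simp)
  have hs : s ≫ kernel.ι e = 𝟙 B' - b ≫ b' - e ≫ p ≫ q' := kernel.lift_ι _ _ _
  let κ : kernel e ⟶ kernel g := kernel.lift g (kernel.ι e ≫ b) (by
    rw [Category.assoc, hbe, kernel.condition_assoc, zero_comp])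
  let κ' : kernel g ⟶ kernel e := kernel.lift e (kernel.ι g ≫ b') (by
    rw [Category.assoc, hbe', kernel.condition_assoc, zero_comp])
  have hκ : κ ≫ kernel.ι g = kernel.ι e ≫ b := kernel.lift_ι _ _ _
  have hκ' : κ' ≫ kernel.ι e = kernel.ι g ≫ b' := kernel.lift_ι _ _ _
  -- The first summand factors through `kernel g`, which is in `T`; the second will too factor
  -- through `T` once `kernel.ι e` does.
  have hid : 𝟙 (kernel e) = κ ≫ κ' + kernel.ι e ≫ s := by
    rw [← cancel_mono (kernel.ι e), Preadditive.add_comp, Category.assoc, Category.assoc, hκ', hs,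
      reassoc_of% hκ, Preadditive.comp_sub, Preadditive.comp_sub, kernel.condition_assoc]
    simp
  have hι : FactorsThrough T (kernel.ι e) := by
    have : kernel.ι e = κ ≫ kernel.ι g ≫ b' + kernel.ι e ≫ (𝟙 B' - b ≫ b') := by
      rw [reassoc_of% hκ, Preadditive.comp_sub]
      simp
    rw [this]
    exact .add ⟨_, hK, κ, _, rfl⟩ (hφ.comp_left _)
  refine prop_of_factorsThrough_id ?_
  rw [hid]
  exact .add ⟨_, hK, κ, κ', rfl⟩ (hι.comp_right s)

end Stable

omit [Abelian A] in
lemma IsTEpic.of_epi (hproj : ∀ P : A, T P → Projective P) {B C : A} (g : B ⟶ C) [Epi g] :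
    IsTEpic T g := by
  intro Q hQ q
  have := hproj Q hQ
  exact ⟨Projective.factorThru q g, Projective.factorThru_comp q g⟩

lemma isIso_of_epi_of_kernel_ι_eq_zero {X Y : A} (f : X ⟶ Y) [Epi f] (h : kernel.ι f = 0) :
    IsIso f := by
  have := Preadditive.mono_of_kernel_zero h
  exact isIso_of_mono_of_epi f

/-! ### Injectives, detected monomorphisms and epimorphisms with kernel in `T`. -/

section Assertions

lemma EmbedsInInjectives.hasNonzeroMapThroughInjective (h : EmbedsInInjectives T) :
    HasNonzeroMapThroughInjective T := by
  intro P hP hP0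
  obtain ⟨E, j, hE, hE', hj⟩ := h P hP
  refine ⟨E, j, hE, fun h0 => hP0 (IsZero.of_mono_eq_zero j h0), E, j, 𝟙 E, hE', by simp⟩

lemma HasNonzeroMapThroughInjective.monoDetected (h : HasNonzeroMapThroughInjective T) :
    MonoDetected T := by
  intro P X j hP hP0 hj
  obtain ⟨P', φ, hP', hφ, E, a, b, hE, rfl⟩ := h P hP hP0
  refine ⟨P', Injective.factorThru a j ≫ b, hP', ?_⟩
  rwa [Injective.comp_factorThru_assoc]

lemma MonoDetected.hasNonzeroMapThroughInjective [EnoughInjectives A] (h : MonoDetected T) :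
    HasNonzeroMapThroughInjective T := by
  intro P hP hP0
  obtain ⟨P', b, hP', hb⟩ := h (Injective.ι P) hP hP0 inferInstance
  exact ⟨P', Injective.ι P ≫ b, hP', hb, Injective.under P, Injective.ι P, b, inferInstance, rfl⟩

lemma MonoDetected.epiVanishingIsIso (h : MonoDetected T) : EpiVanishingIsIso T := by
  intro X Y f hf hK hv
  apply isIso_of_epi_of_kernel_ι_eq_zero
  by_contra hι
  obtain ⟨P', k, hP', hk⟩ := h (kernel.ι f) hK (fun h0 => hι (h0.eq_of_src _ _)) inferInstance
  exact hk (hv hP' k)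

lemma EpiVanishingIsIso.monoDetected [T.IsStableUnderRetracts] (h : EpiVanishingIsIso T) :
    MonoDetected T := by
  intro P X j hP hP0 hj
  by_contra! hv
  -- The kernel of `cokernel.π j` is the image of `j`, isomorphic to `P` as `j` is a monomorphism.
  have : IsIso (cokernel.π j) := by
    refine h (cokernel.π j) inferInstance
      (T.prop_of_iso (asIso (Abelian.factorThruImage j)) hP) fun Q hQ k => ?_
    have hfac : Abelian.factorThruImage j ≫ kernel.ι (cokernel.π j) = j := Abelian.image.fac j
    rw [← cancel_epi (Abelian.factorThruImage j), reassoc_of% hfac, hv Q k hQ, comp_zero]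
  refine hP0 (IsZero.of_mono_eq_zero j ?_)
  rw [← cancel_mono (cokernel.π j), cokernel.condition, zero_comp]

end Assertions

/-! ### Strong monomorphisms, strong epimorphisms and weak balance. -/

section WeaklyBalanced

lemma LeftCandidate.IsIso.refl [ContravariantlyFinite T] (t : LeftCandidate T) :
    LeftCandidate.IsIso T t t :=
  ⟨Iso.refl _, Iso.refl _, Iso.refl _, by simp, by simp, by simp⟩

lemma RightCandidate.IsIso.refl [CovariantlyFinite T] (t : RightCandidate T) :
    RightCandidate.IsIso T t t :=
  ⟨Iso.refl _, Iso.refl _, Iso.refl _, by simp, by simp, by simp⟩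

variable [T.IsClosedUnderFiniteProducts]

lemma isStrongMono_proj_map [ContravariantlyFinite T] {X Y : A} {f : X ⟶ Y} (hf : IsTEpic T f)
    (hK : T (kernel f)) : IsStrongMono T ((proj T).map f) := by
  obtain ⟨l, hl⟩ := hf (cover_isPrecover T Y).mem (cover T Y)
  exact ⟨_, isZero_proj_obj hK, _, _, X, Y, f, hf, l, hl, .refl _⟩

lemma isStrongEpi_proj_map [CovariantlyFinite T] {X Y : A} {f : X ⟶ Y} (hf : IsTMonic T f)
    (hK : T (cokernel f)) : IsStrongEpi T ((proj T).map f) := by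
  obtain ⟨l, hl⟩ := hf (env_isPreenvelope T X).mem (env T X)
  exact ⟨_, isZero_proj_obj hK, _, _, X, Y, f, hf, l, hl, .refl _⟩

variable [T.IsStableUnderRetracts]

lemma WeaklyBalanced.epiVanishingIsIso [FunctoriallyFinite T]
    (hproj : ∀ P : A, T P → Projective P) (h : WeaklyBalanced T) : EpiVanishingIsIso T := by
  intro X Y f hf hK hv
  -- Maps to `T` vanish on the kernel, so they descend along the epimorphism `f`.
  have hm : IsTMonic T f := fun Q hQ q =>
    ⟨Abelian.epiDesc f q (hv hQ q), Abelian.comp_epiDesc f q (hv hQ q)⟩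
  have hC : T (cokernel f) := prop_of_factorsThrough_id
    ⟨⊤_ A, T.prop_terminal, 0, 0, (isZero_cokernel_of_epi f).eq_of_src _ _⟩
  have := h ((proj T).map f) (isStrongMono_proj_map (.of_epi hproj f) hK)
    (isStrongEpi_proj_map hm hC)
  obtain ⟨u, hu⟩ := (proj T).map_surjective (inv ((proj T).map f))
  have hfu : (proj T).map (f ≫ u) = (proj T).map (𝟙 X) := by
    rw [Functor.map_comp, hu, IsIso.hom_inv_id, CategoryTheory.Functor.map_id]
  -- `f ≫ u - 𝟙 X` factors through `T`, hence vanishes on the kernel of `f`; so does `f ≫ u`, and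
  -- therefore the kernel inclusion is zero.
  obtain ⟨P, hP, a, b, hab⟩ := (proj_map_eq_iff _ _).1 hfu
  apply isIso_of_epi_of_kernel_ι_eq_zero
  have := kernel.ι f ≫= hab
  rw [reassoc_of% hv hP a, zero_comp, Preadditive.comp_sub, kernel.condition_assoc, zero_comp,
    Category.comp_id, zero_sub] at this
  exact neg_eq_zero.1 this.symm

/-- A strong epimorphism comes from a `T`-monic `g` with cokernel in `T`. The cokernel is
projective, so it splits off the target; stably the target is the image of `g`, and `g` may be
replaced by its corestriction. -/
lemma IsStrongEpi.exists_epi [CovariantlyFinite T] (hproj : ∀ P : A, T P → Projective P)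
    {X Y : Stable T} {f : X ⟶ Y} (h : IsStrongEpi T f) :
    ∃ (B I : A) (e : B ⟶ I) (_ : Epi e) (_ : IsTMonic T e) (i : (proj T).obj B ≅ X)
      (k : (proj T).obj I ≅ Y), (proj T).map e ≫ k.hom = i.hom ≫ f := by
  obtain ⟨Z, hZ, _, _, B, C, g, hg, l, hl, i, k, c, w, -, -⟩ := h
  change X ≅ (proj T).obj B at i
  change Y ≅ (proj T).obj C at k
  change f ≫ k.hom = i.hom ≫ (proj T).map g at w
  have hC : T (cokernel g) := prop_of_isZero_proj_obj (hZ.of_iso c.symm)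
  have := hproj _ hC
  obtain ⟨s, hs⟩ : ∃ s : cokernel g ⟶ C, s ≫ cokernel.π g = 𝟙 _ :=
    ⟨Projective.factorThru (𝟙 _) (cokernel.π g), Projective.factorThru_comp _ _⟩
  -- The idempotent `𝟙 C - cokernel.π g ≫ s` projects onto the image, and differs from the identity
  -- by a map through `cokernel g`.
  let r : C ⟶ Abelian.image g := kernel.lift _ (𝟙 C - cokernel.π g ≫ s) (by
    rw [Preadditive.sub_comp, Category.assoc, hs]; simp)
  have hr : r ≫ Abelian.image.ι g = 𝟙 C - cokernel.π g ≫ s := kernel.lift_ι _ _ _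
  have hr' : Abelian.image.ι g ≫ r = 𝟙 _ := by
    rw [← cancel_mono (Abelian.image.ι g), Category.assoc, hr, Preadditive.comp_sub,
      kernel.condition_assoc]
    simp
  have hfac : Abelian.factorThruImage g ≫ Abelian.image.ι g = g := Abelian.image.fac g
  let k' : (proj T).obj (Abelian.image g) ≅ (proj T).obj C :=
    { hom := (proj T).map (Abelian.image.ι g)
      inv := (proj T).map r
      hom_inv_id := by rw [← Functor.map_comp, hr', CategoryTheory.Functor.map_id]
      inv_hom_id := by
        rw [← Functor.map_comp, hr, ← CategoryTheory.Functor.map_id, proj_map_eq_iff]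
        exact ⟨_, hC, -cokernel.π g, s, by simp⟩ }
  refine ⟨B, Abelian.image g, Abelian.factorThruImage g, inferInstance, fun Q hQ q => ?_, i.symm,
    k' ≪≫ k.symm, ?_⟩
  · obtain ⟨t, rfl⟩ := hg hQ q
    exact ⟨Abelian.image.ι g ≫ t, by rw [reassoc_of% hfac]⟩
  · change (proj T).map _ ≫ (proj T).map _ ≫ k.inv = i.inv ≫ f
    rw [← Functor.map_comp_assoc, hfac, Iso.comp_inv_eq, Category.assoc, w, Iso.inv_hom_id_assoc]

lemma EpiVanishingIsIso.weaklyBalanced [FunctoriallyFinite T]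
    (hproj : ∀ P : A, T P → Projective P) (h : EpiVanishingIsIso T) : WeaklyBalanced T := by
  intro X Y f hm he
  obtain ⟨B, I, e, _, he, i, k, w⟩ := he.exists_epi hproj
  obtain ⟨Z, hZ, _, _, B', C', g, hg, l, hl, z, i', k', -, -, w'⟩ := hm
  change X ≅ (proj T).obj B' at i'
  change Y ≅ (proj T).obj C' at k'
  change f ≫ k'.hom = i'.hom ≫ (proj T).map g at w'
  have hK : T (kernel g) := prop_of_isZero_proj_obj (hZ.of_iso z.symm)
  have hKe : T (kernel e) := prop_kernel_of_arrow_iso hg (.of_epi hproj e) hK (i ≪≫ i') (k ≪≫ k')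
    (by rw [Iso.trans_hom, Iso.trans_hom, reassoc_of% w, w', Category.assoc])
  -- Being `T`-monic, `e` factors every map from `B` to `T`, so such maps vanish on `kernel e`.
  have := h e inferInstance hKe fun P hP q => by
    obtain ⟨q', rfl⟩ := he hP q
    rw [kernel.condition_assoc, zero_comp]
  have hf : f = i.inv ≫ (proj T).map e ≫ k.hom := by rw [w, Iso.inv_hom_id_assoc]
  rw [hf]
  infer_instance

end WeaklyBalanced

end StableCat

/-! ### Representable subfunctors of `Ext¹(Y, ?)`. -/

namespace StableCat
section Ext

open Abelian

variable {A : Type u} [Category.{v} A] [Abelian A] [HasExt.{w} A] {T : ObjectProperty A}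

lemma MonoDetected.extHasNoRepresentable (h : MonoDetected T) : ExtHasNoRepresentable.{w} T := by
  rintro Y - ⟨F, i, hi, ⟨P, ⟨e⟩⟩, hF⟩
  have hinj (Q : T.FullSubcategory) : Function.Injective (i.app Q).hom :=
    (AddCommGrpCat.mono_iff_injective _).1 inferInstance
  let s (Q : T.FullSubcategory) (f : P ⟶ Q) : F.obj Q := ((e.inv.app Q).hom ⟨f⟩).down
  have hs (Q : T.FullSubcategory) : Function.Bijective (s Q) := by
    have := ConcreteCategory.bijective_of_isIso (e.inv.app Q)
    exact ULift.down_bijective.comp (this.comp ULift.up_bijective)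
  have hnat {Q Q' : T.FullSubcategory} (f : P ⟶ Q) (g : Q ⟶ Q') :
      s Q' (f ≫ g) = (F.map g).hom (s Q f) :=
    congrArg ULift.down (ConcreteCategory.congr_hom (e.inv.naturality g) ⟨f⟩)
  -- The universal element given by Yoneda: the embedding of `T(P, ?)` sends `f` to the pushout of
  -- `x` along `f`.
  let x : Ext.{w} Y P.obj 1 := (i.app P).hom (s P (𝟙 P))
  have hx {Q : T.FullSubcategory} (f : P ⟶ Q) :
      x.comp (Ext.mk₀ f.hom) (add_zero 1) = (i.app Q).hom (s Q f) := by
    rw [← Category.id_comp f, hnat, Category.id_comp]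
    exact (ConcreteCategory.congr_hom (i.naturality f) (s P (𝟙 P))).symm
  have hP : ¬ IsZero P.obj := by
    intro h0
    refine hF ((Functor.isZero_iff F).2 fun Q => ?_)
    have : Subsingleton (P ⟶ Q) := ⟨fun f g => ObjectProperty.hom_ext _ (h0.eq_of_src _ _)⟩
    have : Subsingleton (F.obj Q) := (hs Q).2.subsingleton
    exact AddCommGrpCat.isZero_of_subsingleton _
  obtain ⟨X, j, hj, hxj⟩ := x.exists_mono_comp_eq_zero
  obtain ⟨P', k, hP', hk⟩ := h j P.property hP hj
  apply hk
  -- Since `j` kills `x`, so does `j ≫ k`; injectivity of the embedding then gives `j ≫ k = 0`.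
  let f : P ⟶ ⟨P', hP'⟩ := ObjectProperty.homMk (j ≫ k)
  have hf : x.comp (Ext.mk₀ f.hom) (add_zero 1) =
      x.comp (Ext.mk₀ (0 : P ⟶ ⟨P', hP'⟩).hom) (add_zero 1) := by
    have : x.comp (Ext.mk₀ (j ≫ k)) (add_zero 1) = 0 := by
      rw [← Ext.mk₀_comp_mk₀, ← Ext.comp_assoc_of_third_deg_zero, hxj, Ext.zero_comp]
    refine this.trans ?_
    change 0 = x.comp (Ext.mk₀ 0) (add_zero 1)
    rw [Ext.mk₀_zero, Ext.comp_zero]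
  rw [hx, hx] at hf
  exact congrArg (fun f => f.hom) ((hs _).1 (hinj _ hf))

/-- The subgroup of `Ext¹(Y, Q)` of the pushouts of a class `x ∈ Ext¹(Y, P)`. -/
noncomputable def pushoutClasses {Y P : A} (x : Ext.{w} Y P 1) (Q : A) :
    AddSubgroup (Ext.{w} Y Q 1) :=
  AddMonoidHom.range (Ext.bilinearComp Y P Q 1 0 1 (add_zero 1) x)

lemma comp_mk₀_mem_pushoutClasses {Y P Q Q' : A} {x : Ext.{w} Y P 1} {y : Ext.{w} Y Q 1}
    (hy : y ∈ pushoutClasses x Q) (g : Q ⟶ Q') :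
    y.comp (Ext.mk₀ g) (add_zero 1) ∈ pushoutClasses x Q' := by
  obtain ⟨z, rfl⟩ := hy
  exact ⟨z.comp (Ext.mk₀ g) (add_zero 0), (Ext.comp_assoc_of_third_deg_zero x z _ (add_zero 1)).symm⟩

variable (T) in
/-- The subfunctor of `Ext¹(Y, ?)` generated by a class `x ∈ Ext¹(Y, P)`. -/
noncomputable def extSubfunctor {Y P : A} (x : Ext.{w} Y P 1) :
    T.FullSubcategory ⥤ AddCommGrpCat.{w} where
  obj Q := AddCommGrpCat.of (pushoutClasses x Q.obj)
  map {Q Q'} g := AddCommGrpCat.ofHom (AddMonoidHom.mk'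
    (fun y => ⟨y.1.comp (Ext.mk₀ g.hom) (add_zero 1), comp_mk₀_mem_pushoutClasses y.2 g.hom⟩)
    fun y y' => Subtype.ext (Ext.add_comp y.1 y'.1 _ (add_zero 1)))
  map_id Q := by
    ext y
    exact Ext.comp_mk₀_id y.1
  map_comp g g' := by
    ext y
    change y.1.comp (Ext.mk₀ (g.hom ≫ g'.hom)) (add_zero 1) =
      (y.1.comp (Ext.mk₀ g.hom) (add_zero 1)).comp (Ext.mk₀ g'.hom) (add_zero 1)
    rw [← Ext.mk₀_comp_mk₀, ← Ext.comp_assoc_of_third_deg_zero]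

variable (T) in
/-- The inclusion of `extSubfunctor T x` in `Ext¹(Y, ?)`. -/
noncomputable def extSubfunctorι {Y P : A} (x : Ext.{w} Y P 1) :
    extSubfunctor T x ⟶ extRestrict.{w} T Y where
  app Q := AddCommGrpCat.ofHom (pushoutClasses x Q.obj).subtype
  naturality _ _ _ := rfl

instance {Y P : A} (x : Ext.{w} Y P 1) : Mono (extSubfunctorι T x) := by
  have (Q : T.FullSubcategory) : Mono ((extSubfunctorι T x).app Q) :=
    (AddCommGrpCat.mono_iff_injective _).2 Subtype.val_injective
  exact NatTrans.mono_of_mono_app _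

/-- The map `f ↦ x·f` is onto the pushout classes because `Ext⁰` is Hom, and the hypothesis is its
injectivity. -/
lemma isRepresentable_extSubfunctor {Y : A} (P : T.FullSubcategory) (x : Ext.{w} Y P.obj 1)
    (hx : ∀ (Q : T.FullSubcategory) (f : P ⟶ Q), x.comp (Ext.mk₀ f.hom) (add_zero 1) = 0 → f = 0) :
    IsRepresentable T (extSubfunctor T x) := by
  let φ (Q : T.FullSubcategory) : (P ⟶ Q) →+ (extSubfunctor T x).obj Q :=
    { toFun f := ⟨x.comp (Ext.mk₀ f.hom) (add_zero 1), Ext.mk₀ f.hom, rfl⟩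
      map_zero' := Subtype.ext (by
        change x.comp (Ext.mk₀ 0) (add_zero 1) = 0
        rw [Ext.mk₀_zero, Ext.comp_zero])
      map_add' f g := Subtype.ext (by
        change x.comp (Ext.mk₀ (f.hom + g.hom)) (add_zero 1) = _
        rw [Ext.mk₀_add, Ext.comp_add]
        rfl) }
  have hφ (Q : T.FullSubcategory) : Function.Bijective (φ Q) := by
    constructor
    · rw [injective_iff_map_eq_zero]
      exact fun f hf => hx Q f (congrArg Subtype.val hf)
    · rintro ⟨_, y, rfl⟩
      refine ⟨ObjectProperty.homMk (Ext.homEquiv₀ y), Subtype.ext ?_⟩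
      change x.comp (Ext.mk₀ (Ext.homEquiv₀ y)) (add_zero 1) = _
      rw [Ext.mk₀_homEquiv₀_apply]
      rfl
  refine ⟨P, ⟨(NatIso.ofComponents (fun Q => (AddEquiv.toAddCommGrpIso
    ((AddEquiv.ulift.trans (AddEquiv.ofBijective (φ Q) (hφ Q))).trans AddEquiv.ulift.symm))) ?_).symm⟩⟩
  intro Q Q' g
  ext ⟨f⟩
  refine congrArg ULift.up (Subtype.ext (?_ : x.comp (Ext.mk₀ (f.hom ≫ g.hom)) (add_zero 1) =
    (x.comp (Ext.mk₀ f.hom) (add_zero 1)).comp (Ext.mk₀ g.hom) (add_zero 1)))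
  rw [← Ext.mk₀_comp_mk₀, ← Ext.comp_assoc_of_third_deg_zero]

lemma ExtHasNoRepresentable.monoDetected (h : ExtHasNoRepresentable.{w} T) :
    MonoDetected T := by
  intro P X j hP hP0 hj
  by_contra! hv
  have hS : (ShortComplex.mk j (cokernel.π j) (cokernel.condition j)).ShortExact :=
    { exact := ShortComplex.exact_cokernel j }
  -- By the long exact sequence, `f` extends along `j` if the pushout of the extension class is
  -- zero; but maps from `X` to `T` vanish on `P`.
  have hx (Q : T.FullSubcategory) (f : (⟨P, hP⟩ : T.FullSubcategory) ⟶ Q)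
      (hf : hS.extClass.comp (Ext.mk₀ f.hom) (add_zero 1) = 0) : f = 0 := by
    obtain ⟨y, hy⟩ := Ext.contravariant_sequence_exact₁ hS Q.obj (Ext.mk₀ f.hom) (add_zero 1) hf
    obtain ⟨k, rfl⟩ := Ext.homEquiv₀.symm.surjective y
    rw [Ext.homEquiv₀_symm_apply, Ext.mk₀_comp_mk₀] at hy
    have hjk : f.hom = j ≫ k := ((Ext.mk₀_bijective _ _).1 hy).symm
    ext
    rw [hjk, hv Q.obj k Q.property]
    rfl
  have hne : hS.extClass ≠ 0 := by
    intro h0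
    have := hx ⟨P, hP⟩ (𝟙 _) (by rw [h0, Ext.zero_comp])
    exact hP0 ((IsZero.iff_id_eq_zero P).2 (congrArg (fun f => f.hom) this))
  have hF : ¬ IsZero (extSubfunctor T hS.extClass) := by
    intro h0
    have : Subsingleton (pushoutClasses hS.extClass P) :=
      AddCommGrpCat.subsingleton_of_isZero ((Functor.isZero_iff _).1 h0 ⟨P, hP⟩)
    -- The extension class is its own pushout along the identity, hence a nonzero element of the
    -- subfunctor at `P`.
    exact hne (congrArg Subtype.val (Subsingleton.elim
      (⟨_, Ext.mk₀ (𝟙 P), Ext.comp_mk₀_id _⟩ :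
        pushoutClasses hS.extClass P) 0))
  refine h (cokernel j) (fun h0 => ?_)
    ⟨_, extSubfunctorι T hS.extClass, inferInstance, isRepresentable_extSubfunctor ⟨P, hP⟩ _ hx, hF⟩
  have := AddCommGrpCat.subsingleton_of_isZero ((Functor.isZero_iff _).1 h0 ⟨P, hP⟩)
  exact hne (Subsingleton.elim (α := (extRestrict.{w} T (cokernel j)).obj ⟨P, hP⟩) _ _)

end Ext

end StableCat

theorem theorem5p4 {A : Type u} [Category.{v} A] [Abelian A] [HasExt.{w} A]
    (T : ObjectProperty A) [T.IsClosedUnderFiniteProducts] [T.IsStableUnderRetracts]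
    [StableCat.FunctoriallyFinite T] (hproj : ∀ P : A, T P → Projective P) :
    (StableCat.EmbedsInInjectives T → StableCat.HasNonzeroMapThroughInjective T) ∧
    (StableCat.HasNonzeroMapThroughInjective T → StableCat.WeaklyBalanced T) ∧
    (StableCat.WeaklyBalanced T ↔ StableCat.EpiVanishingIsIso T) ∧
    (StableCat.EpiVanishingIsIso T ↔ StableCat.MonoDetected T) ∧
    (StableCat.MonoDetected T ↔ StableCat.ExtHasNoRepresentable.{w} T) ∧
    (EnoughInjectives A →
      List.TFAE [StableCat.HasNonzeroMapThroughInjective T,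
        StableCat.WeaklyBalanced T,
        StableCat.EpiVanishingIsIso T,
        StableCat.MonoDetected T,
        StableCat.ExtHasNoRepresentable.{w} T]) := by
  have h24 : StableCat.HasNonzeroMapThroughInjective T → StableCat.EpiVanishingIsIso T :=
    fun h => h.monoDetected.epiVanishingIsIso
  have h34 : StableCat.WeaklyBalanced T ↔ StableCat.EpiVanishingIsIso T :=
    ⟨fun h => h.epiVanishingIsIso hproj, fun h => h.weaklyBalanced hproj⟩
  have h45 : StableCat.EpiVanishingIsIso T ↔ StableCat.MonoDetected T :=
    ⟨fun h => h.monoDetected, fun h => h.epiVanishingIsIso⟩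
  have h56 : StableCat.MonoDetected T ↔ StableCat.ExtHasNoRepresentable.{w} T :=
    ⟨fun h => h.extHasNoRepresentable, fun h => h.monoDetected⟩
  refine ⟨fun h => h.hasNonzeroMapThroughInjective, fun h => h34.2 (h24 h), h34, h45, h56, ?_⟩
  intro _
  have h25 : StableCat.HasNonzeroMapThroughInjective T ↔ StableCat.MonoDetected T :=
    ⟨fun h => h.monoDetected, fun h => h.hasNonzeroMapThroughInjective⟩
  tfae_have 1 ↔ 4 := h25
  tfae_have 2 ↔ 3 := h34
  tfae_have 3 ↔ 4 := h45
  tfae_have 4 ↔ 5 := h56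
  tfae_finish
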